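/- Let $X$ be a real reflexive Banach space with continuous dual $X^*$, and let $A\colon X\rightrightarrows X^*$ be a linear relation, i.e. a set-valued operator whose graph $\operatorname{gra}A=\{(x,x^*)\in X\times X^* : x^*\in Ax\}$ is a linear subspace of $X\times X^*$. Assume that $\operatorname{gra}A$ is closed. Let $A^*\colon X\rightrightarrows X^*$ be the adjoint of $A$, given by $$\operatorname{gra}A^*=\{(x,x^*)\in X\times X^* : \langle y,x^*\rangle-\langle x,y^*\rangle=0\ \text{ for all }(y,y^*)\in\operatorname{gra}A\}.$$ A set-valued operator $B\colon X\rightrightarrows X^*$ is called monotone if $\langle x-y,x^*-y^*\rangle\ge 0$ for all $(x,x^*),(y,y^*)\in\operatorname{gra}B$, and maximal monotone if it is monotone and its graph is not properly contained in the graph of any monotone operator. Then $A$ is maximal monotone if and only if $A^*$ is maximal monotone. If, moreover, $A$ is monotone, then the following three statements are equivalent: 1. $A$ is maximal monotone. 2. $A^*$ is maximal monotone. 3. $A^*$ is monotone. -/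

import Mathlib

/-- `X` is reflexive: the canonical embedding of `X` into its bidual is onto. -/
def IsReflexiveSpace (X : Type*) [NormedAddCommGroup X] [NormedSpace ℝ X] : Prop :=
  Function.Surjective (NormedSpace.inclusionInDoubleDual ℝ X)

/-- A set-valued operator (multifunction) `A : X ⇉ X*`. -/
abbrev Multifunction (X : Type*) [NormedAddCommGroup X] [NormedSpace ℝ X] : Type _ :=
  X → Set (StrongDual ℝ X)

namespace Multifunction

variable {X : Type*} [NormedAddCommGroup X] [NormedSpace ℝ X]

/-- The graph `{(x, x*) | x* ∈ A x}`. -/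
def graph (A : Multifunction X) : Set (X × StrongDual ℝ X) :=
  {p | p.2 ∈ A p.1}

/-- `A` is a linear relation: its graph is a linear subspace of `X × X*`. -/
def IsLinearRelation (A : Multifunction X) : Prop :=
  ∃ S : Submodule ℝ (X × StrongDual ℝ X), (S : Set (X × StrongDual ℝ X)) = A.graph

/-- `A` is monotone: `⟨x - y, x* - y*⟩ ≥ 0` for all `(x, x*)`, `(y, y*)` in the graph. -/
def IsMonotone (A : Multifunction X) : Prop :=
  ∀ p ∈ A.graph, ∀ q ∈ A.graph, 0 ≤ (p.2 - q.2) (p.1 - q.1)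

/-- `A` is maximal monotone: it is monotone and has no proper monotone extension. -/
def IsMaximalMonotone (A : Multifunction X) : Prop :=
  A.IsMonotone ∧
    ∀ B : Multifunction X, B.IsMonotone → A.graph ⊆ B.graph → B.graph = A.graph

/-- The adjoint `A* : X ⇉ X*`. Its graph is the set of all `(x, x*)` such that `(x*, -x)`
annihilates the graph of `A`, where `(x*, x)` acts on `X × X*` by
`(y, y*) ↦ ⟨y, x*⟩ + ⟨x, y*⟩`. -/
def adjoint (A : Multifunction X) : Multifunction X :=
  fun x => {x' | ∀ q ∈ A.graph, x' q.1 + q.2 (-x) = 0}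

end Multifunction

/-!
The proof rests on two facts about a linear relation `A` with graph `S`, written with the
quadratic form `q (x, x') = ⟨x, x'⟩`, its polar form `[·, ·]` and the norm
`‖(x, x')‖² = ‖x‖² + ‖x'‖²` on `X × X*`. The adjoint relation is, up to the sign change
`(x, x') ↦ (-x, x')`, the annihilator of `S` for `[·, ·]`; in particular `A** = A` when `S` is closed
and `X` is reflexive (`adjoint_adjoint`).

* If `A` is maximal monotone, then `A*` is monotone (`IsMaximalMonotone.isMonotone_adjoint`):
  a point `(x, x')` of the graph of `A*` with `⟨x, x'⟩ < 0` makes `(-x, x')` monotonically related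
  to `S`, hence a point of `S`, and pairing it with `(x, x')` gives `⟨x, x'⟩ = 0`.
* If `A` and `A*` are monotone and `S` is closed, then `A` is maximal monotone
  (`isMaximalMonotone_of_isMonotone_adjoint`). Let `z` be monotonically related to `S`. On `S - z`
  the form `q` is nonnegative, so `½‖w‖² + q(w)` is bounded below there. At a minimizer `w` the
  Hahn-Banach theorem gives `a` with `[a, w] = ‖a‖² = ‖w‖²` and `w + a` in the annihilator of `S`,
  where `q ≤ 0` because `A*` is monotone. Then `q (w + a) = q(w) + [a, w] + q(a)` is at least
  `0 + ‖w‖² - ½‖a‖² = ½‖w‖²`, which forces `w = 0`, so `z ∈ S`. Weak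
  compactness is avoided by working with approximate minimizers: the same computation with error
  terms gives points of `S` that converge to `z` in norm (`exists_mem_norm_sq_sub_le`).

Applying both facts to `A` and to `A*` gives all the implications.
-/

/-! ### Consequences of the Hahn-Banach theorem -/

/-- A sandwich theorem: a continuous convex function that is nonnegative on a subspace `S`
dominates a continuous linear functional that vanishes on `S`. -/
theorem exists_dual_le_of_nonneg_on_submodule {E : Type*} [NormedAddCommGroup E] [NormedSpace ℝ E]
    (S : Submodule ℝ E) {p : E → ℝ} (hconv : ConvexOn ℝ Set.univ p) (hcont : Continuous p)
    (hp : ∀ e ∈ S, 0 ≤ p e) :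
    ∃ l : StrongDual ℝ E, (∀ e, l e ≤ p e) ∧ ∀ e ∈ S, l e = 0 := by
  have hopen : IsOpen {a : E × ℝ | p a.1 < a.2} :=
    isOpen_lt (hcont.comp continuous_fst) continuous_snd
  have hcv : Convex ℝ {a : E × ℝ | p a.1 < a.2} := by
    simpa using hconv.convex_strict_epigraph
  have hdisj : Disjoint {a : E × ℝ | p a.1 < a.2} (S.prod ⊥ : Submodule ℝ (E × ℝ)) := by
    rw [Set.disjoint_left]
    rintro ⟨e, r⟩ h1 h2
    obtain ⟨h2, h3⟩ := Submodule.mem_prod.1 h2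
    have h3 : r = 0 := by simpa using h3
    have h1 : p e < r := h1
    linarith [hp e h2]
  obtain ⟨f, u, hs, ht⟩ := geometric_hahn_banach_open hcv hopen (S.prod ⊥).convex hdisj
  have hu : u ≤ 0 := by simpa using ht 0 (Submodule.zero_mem _)
  have hf : ∀ e r, f (e, r) = f (e, 0) + r * f (0, 1) := by
    intro e r
    have : ((e, r) : E × ℝ) = (e, 0) + r • ((0 : E), (1 : ℝ)) := by simp
    rw [this, map_add, map_smul, smul_eq_mul]
  have hS : ∀ e ∈ S, f (e, 0) = 0 := by
    intro e he
    have key : ∀ t : ℝ, u ≤ t * f (e, 0) := by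
      intro t
      have h := ht (t • (e, 0)) (Submodule.smul_mem _ _ (Submodule.mem_prod.2 ⟨he, by simp⟩))
      rwa [map_smul, smul_eq_mul] at h
    by_contra hne
    have h := key ((u - 1) / f (e, 0))
    rw [div_mul_cancel₀ _ hne] at h
    linarith
  have hc : f (0, 1) < 0 := by
    have h0 := hp 0 S.zero_mem
    have h := hs ((0 : E), p 0 + 1) (by simp)
    rw [hf, show ((0 : E), (0 : ℝ)) = 0 from rfl, map_zero] at h
    nlinarith
  have hle : ∀ e, f (e, 0) + p e * f (0, 1) ≤ 0 := by
    intro e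
    by_contra! hlt
    set ε := (f (e, 0) + p e * f (0, 1)) / (-f (0, 1)) with hε
    have hεpos : 0 < ε := div_pos hlt (by linarith)
    have h := hs (e, p e + ε) (by simpa using hεpos)
    rw [hf] at h
    have : ε * f (0, 1) = -(f (e, 0) + p e * f (0, 1)) := by
      rw [hε, div_mul_eq_mul_div, div_eq_iff (by linarith)]
      ring
    nlinarith
  refine ⟨(-f (0, 1))⁻¹ • f.comp (ContinuousLinearMap.inl ℝ E ℝ), fun e => ?_, fun e he => ?_⟩
  · have : (-f (0, 1))⁻¹ * f (e, 0) ≤ p e := by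
      rw [inv_mul_le_iff₀ (by linarith)]
      linarith [hle e]
    simpa using this
  · simp [hS e he]

/-- A point outside a closed subspace is separated from it by a continuous linear functional that
vanishes on the subspace. -/
theorem exists_dual_ne_zero_of_notMem {E : Type*} [NormedAddCommGroup E] [NormedSpace ℝ E]
    (S : Submodule ℝ E) (hS : IsClosed (S : Set E)) {x : E} (hx : x ∉ S) :
    ∃ l : StrongDual ℝ E, l x ≠ 0 ∧ ∀ e ∈ S, l e = 0 := by
  obtain ⟨f, u, hs, hu⟩ := geometric_hahn_banach_closed_point S.convex hS hx
  have h0 : 0 < u := by simpa using hs 0 S.zero_mem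
  refine ⟨f, by linarith, fun e he => ?_⟩
  by_contra hne
  have h := hs ((u / f e) • e) (S.smul_mem _ he)
  rw [map_smul, smul_eq_mul, div_mul_cancel₀ _ hne] at h
  exact lt_irrefl _ h

/-! ### Conjugates of quadratic functions of the norm -/

section Conjugate

variable {E F : Type*} [NormedAddCommGroup E] [NormedSpace ℝ E] [NormedAddCommGroup F]
  [NormedSpace ℝ F]

theorem norm_sq_le_of_forall_le {f : StrongDual ℝ E} {k c : ℝ} (hk : 0 ≤ k)
    (h : ∀ u, f u ≤ k / 2 * ‖u‖ ^ 2 + c) : ‖f‖ ^ 2 ≤ 2 * k * c := by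
  have hc : 0 ≤ c := by simpa using h 0
  have hkc : 0 ≤ 2 * k * c := by positivity
  suffices ‖f‖ ≤ √(2 * k * c) by
    calc ‖f‖ ^ 2 ≤ √(2 * k * c) ^ 2 := by gcongr
      _ = _ := Real.sq_sqrt hkc
  refine f.opNorm_le_bound (Real.sqrt_nonneg _) fun u => ?_
  -- the quadratic `t ↦ (k/2)‖u‖² t² - f u t + c` is nonnegative
  have hdisc : discrim (k / 2 * ‖u‖ ^ 2) (-f u) c ≤ 0 := by
    refine discrim_le_zero fun t => ?_
    have := h (t • u)
    rw [map_smul, smul_eq_mul, norm_smul, mul_pow, Real.norm_eq_abs, sq_abs] at this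
    linarith
  rw [discrim] at hdisc
  rw [Real.norm_eq_abs]
  refine abs_le_of_sq_le_sq ?_ (by positivity)
  rw [mul_pow, Real.sq_sqrt hkc]
  linarith

/-- Half the squared norm of `E × F` for the Hilbert sum norm has half the squared dual norm as its
conjugate; here for the multiple `k` and in the form of a bound. -/
theorem norm_sq_add_norm_sq_le_of_forall_le {f : StrongDual ℝ E} {g : StrongDual ℝ F} {k c : ℝ}
    (hk : 0 ≤ k) (h : ∀ u v, f u + g v ≤ k / 2 * (‖u‖ ^ 2 + ‖v‖ ^ 2) + c) :
    ‖f‖ ^ 2 + ‖g‖ ^ 2 ≤ 2 * k * c := by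
  rcases hk.eq_or_lt with rfl | hk
  · have hf : ‖f‖ ^ 2 ≤ 2 * 0 * c :=
      norm_sq_le_of_forall_le le_rfl fun u => by simpa using h u 0
    have hg : ‖g‖ ^ 2 ≤ 2 * 0 * c :=
      norm_sq_le_of_forall_le le_rfl fun v => by simpa using h 0 v
    linarith
  have hf : ∀ v, ‖f‖ ^ 2 ≤ 2 * k * (k / 2 * ‖v‖ ^ 2 + c - g v) := fun v =>
    norm_sq_le_of_forall_le hk.le fun u => by linarith [h u v]
  have hg : ‖g‖ ^ 2 ≤ 2 * k * (c - ‖f‖ ^ 2 / (2 * k)) := by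
    refine norm_sq_le_of_forall_le hk.le fun v => ?_
    have : ‖f‖ ^ 2 / (2 * k) ≤ k / 2 * ‖v‖ ^ 2 + c - g v := by
      rw [div_le_iff₀' (by positivity)]
      exact hf v
    linarith
  have : 2 * k * (c - ‖f‖ ^ 2 / (2 * k)) = 2 * k * c - ‖f‖ ^ 2 := by field_simp
  linarith

end Conjugate

theorem convexOn_norm_sq_add {E : Type*} [NormedAddCommGroup E] [NormedSpace ℝ E] (a : E) :
    ConvexOn ℝ Set.univ fun e : E => ‖a + e‖ ^ 2 := by
  have h : ConvexOn ℝ Set.univ fun e : E => ‖a + e‖ := by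
    have := (convexOn_univ_norm (E := E)).translate_right a
    simpa [Function.comp_def] using this
  exact h.pow (fun _ _ => norm_nonneg _) 2

namespace Multifunction

variable {X : Type*} [NormedAddCommGroup X] [NormedSpace ℝ X]

/-! ### Linear relations and adjoints -/

theorem mem_graph_adjoint {A : Multifunction X} {p : X × StrongDual ℝ X} :
    p ∈ A.adjoint.graph ↔ ∀ s ∈ A.graph, p.2 s.1 = s.2 p.1 := by
  change (∀ s ∈ A.graph, p.2 s.1 + s.2 (-p.1) = 0) ↔ _
  simp only [map_neg, ← sub_eq_add_neg, sub_eq_zero]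

theorem isLinearRelation_adjoint (A : Multifunction X) : A.adjoint.IsLinearRelation := by
  refine ⟨{ carrier := A.adjoint.graph, add_mem' := ?_, zero_mem' := ?_, smul_mem' := ?_ }, rfl⟩
  · intro a b ha hb
    rw [mem_graph_adjoint] at *
    intro s hs
    simp [ha s hs, hb s hs]
  · rw [mem_graph_adjoint]
    simp
  · intro c a ha
    rw [mem_graph_adjoint] at *
    intro s hs
    simp [ha s hs]

theorem isClosed_graph_adjoint (A : Multifunction X) : IsClosed A.adjoint.graph := by
  have : A.adjoint.graph = ⋂ s ∈ A.graph, {p : X × StrongDual ℝ X | p.2 s.1 = s.2 p.1} := by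
    ext p
    simp [mem_graph_adjoint]
  rw [this]
  exact isClosed_biInter fun s _ => isClosed_eq (by fun_prop) (by fun_prop)

/-- On a reflexive space every continuous linear functional on `X × X*` is given by a point of
`X* × X`. -/
theorem exists_dual_prod_eq (hX : IsReflexiveSpace X) (l : StrongDual ℝ (X × StrongDual ℝ X)) :
    ∃ (f : StrongDual ℝ X) (c : X), ∀ u v, l (u, v) = f u + v c := by
  obtain ⟨c, hc⟩ := hX (l.comp (ContinuousLinearMap.inr ℝ X (StrongDual ℝ X)))
  refine ⟨l.comp (ContinuousLinearMap.inl ℝ X (StrongDual ℝ X)), c, fun u v => ?_⟩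
  have h := DFunLike.congr_fun hc v
  simp only [NormedSpace.dual_def, ContinuousLinearMap.comp_apply,
    ContinuousLinearMap.inr_apply] at h
  rw [h, ContinuousLinearMap.comp_apply, ContinuousLinearMap.inl_apply, ← map_add]
  simp

theorem adjoint_adjoint (hX : IsReflexiveSpace X) {A : Multifunction X}
    (hlin : A.IsLinearRelation) (hclosed : IsClosed A.graph) : A.adjoint.adjoint = A := by
  obtain ⟨S, hS⟩ := hlin
  suffices h : A.adjoint.adjoint.graph = A.graph by
    funext x
    ext x'
    exact Set.ext_iff.1 h (x, x')
  ext p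
  constructor
  · intro hp
    by_contra hpS
    rw [← hS] at hpS hclosed
    obtain ⟨l, hlp, hl⟩ := exists_dual_ne_zero_of_notMem S hclosed hpS
    obtain ⟨f, c, hfc⟩ := exists_dual_prod_eq hX l
    have hmem : (-c, f) ∈ A.adjoint.graph := by
      rw [mem_graph_adjoint]
      intro s hs
      have h := hl s (by rwa [← hS] at hs)
      rw [← Prod.mk.eta (p := s), hfc] at h
      simp only [map_neg]
      linarith
    have h := mem_graph_adjoint.1 hp _ hmem
    apply hlp
    rw [← Prod.mk.eta (p := p), hfc]
    simp only [map_neg] at h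
    linarith
  · intro hp
    rw [mem_graph_adjoint]
    intro s hs
    exact (mem_graph_adjoint.1 hs p hp).symm

/-! ### Monotonicity -/

theorem IsLinearRelation.isMonotone_iff {A : Multifunction X} (hlin : A.IsLinearRelation) :
    A.IsMonotone ↔ ∀ p ∈ A.graph, 0 ≤ p.2 p.1 := by
  obtain ⟨S, hS⟩ := hlin
  unfold IsMonotone
  rw [← hS]
  constructor
  · intro h p hp
    simpa using h p hp 0 S.zero_mem
  · intro h p hp q hq
    exact h (p - q) (S.sub_mem hp hq)

/-- A maximal monotone operator contains every point that is monotonically related to its graph. -/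
theorem IsMaximalMonotone.mem_graph {A : Multifunction X} (hA : A.IsMaximalMonotone)
    {z : X × StrongDual ℝ X} (hz : ∀ s ∈ A.graph, 0 ≤ (s.2 - z.2) (s.1 - z.1)) :
    z ∈ A.graph := by
  let B : Multifunction X := fun x => {x' | (x, x') ∈ insert z A.graph}
  have hB : B.graph = insert z A.graph := rfl
  have hmono : B.IsMonotone := by
    intro p hp q hq
    rw [hB] at hp hq
    rcases hp with rfl | hp <;> rcases hq with rfl | hq
    · simp
    · have h := hz q hq
      rw [← neg_sub p.2, ← neg_sub p.1] at h
      rwa [neg_apply, map_neg, neg_neg] at h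
    · exact hz p hp
    · exact hA.1 p hp q hq
  rw [← hA.2 B hmono (hB ▸ Set.subset_insert _ _), hB]
  exact Set.mem_insert _ _

theorem isMaximalMonotone_of_mem_graph {A : Multifunction X} (hA : A.IsMonotone)
    (h : ∀ z : X × StrongDual ℝ X, (∀ s ∈ A.graph, 0 ≤ (s.2 - z.2) (s.1 - z.1)) → z ∈ A.graph) :
    A.IsMaximalMonotone :=
  ⟨hA, fun _ hB hAB => Set.Subset.antisymm (fun z hz => h z fun s hs => hB s (hAB hs) z hz) hAB⟩

theorem IsMaximalMonotone.isMonotone_adjoint {A : Multifunction X} (hlin : A.IsLinearRelation)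
    (hA : A.IsMaximalMonotone) : A.adjoint.IsMonotone := by
  rw [A.isLinearRelation_adjoint.isMonotone_iff]
  intro p hp
  by_contra! hneg
  have hp' := mem_graph_adjoint.1 hp
  have hmem : (-p.1, p.2) ∈ A.graph := by
    refine hA.mem_graph fun s hs => ?_
    have h1 := hlin.isMonotone_iff.1 hA.1 s hs
    have h2 := hp' s hs
    simp only [sub_neg_eq_add, map_add, sub_apply]
    linarith
  have h := hp' _ hmem
  simp only [map_neg] at h
  linarith

/-! ### Maximality from monotonicity of the adjoint -/

/-- The error analysis at an approximate minimizer `w` with multiplier `a`: here `m = ‖w‖²`,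
`n = ‖a‖²`, `b = [a, w]`, `qw = q(w)` and `qa = q(a)`. -/
theorem le_of_approx_duality {m n b qw qa δ : ℝ} (hn : 0 ≤ n) (hm : 0 ≤ m) (hδ : 0 < δ)
    (hδ' : δ ≤ 1 / 26) (hnb : n ≤ (1 + 2 * δ) * (2 * b - m + 2 * δ * (m + 1)))
    (hqw : 0 ≤ qw) (hqa : -(n / 2) ≤ qa) (hq : qa + b + qw ≤ 0) (hb : 2 * b ≤ n / 2 + 2 * m) :
    m ≤ 26 * δ := by
  set K := 2 * b - m + 2 * δ * (m + 1) with hK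
  have h1 : δ * (m + 1) ≤ 1 / 26 * (m + 1) := by gcongr
  have hK0 : 0 ≤ K := by
    by_contra! h
    nlinarith
  have h2 : δ * K ≤ 1 / 26 * K := by gcongr
  have hK5 : K ≤ 5 * (m + 1) := by linarith
  have h3 : δ * K ≤ δ * (5 * (m + 1)) := by gcongr
  have h4 : m ≤ 13 * (δ * (m + 1)) := by
    have : 0 ≤ δ * (m + 1) := by positivity
    linarith
  have h5 : δ * m ≤ 1 / 26 * m := by gcongr
  linarith

/-- If the adjoint of a subspace `S` is monotone, then every point that is monotonically related
to `S` is a limit of points of `S`. -/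
theorem exists_mem_norm_sq_sub_le (hX : IsReflexiveSpace X)
    (S : Submodule ℝ (X × StrongDual ℝ X))
    (hadj : ∀ (x : X) (x' : StrongDual ℝ X), (∀ s ∈ S, x' s.1 = s.2 x) → 0 ≤ x' x)
    (z : X × StrongDual ℝ X) (hz : ∀ s ∈ S, 0 ≤ (s.2 - z.2) (s.1 - z.1))
    {δ : ℝ} (hδ : 0 < δ) (hδ' : δ ≤ 1 / 26) :
    ∃ s ∈ S, ‖s.1 - z.1‖ ^ 2 + ‖s.2 - z.2‖ ^ 2 ≤ 26 * δ := by
  let φ : X × StrongDual ℝ X → ℝ := fun w => (‖w.1‖ ^ 2 + ‖w.2‖ ^ 2) / 2 + w.2 w.1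
  -- an approximate minimizer `s₀ - z` of `φ` on `S - z`
  obtain ⟨s₀, hs₀, hmin⟩ : ∃ s₀ ∈ S, ∀ s ∈ S, φ (s₀ - z) - δ ^ 2 ≤ φ (s - z) := by
    have hne : ((fun s => φ (s - z)) '' (S : Set (X × StrongDual ℝ X))).Nonempty :=
      ⟨_, 0, S.zero_mem, rfl⟩
    have hbdd : BddBelow ((fun s => φ (s - z)) '' (S : Set (X × StrongDual ℝ X))) := by
      refine ⟨0, ?_⟩
      rintro _ ⟨s, hs, rfl⟩
      have := hz s hs
      simp only [φ, Prod.fst_sub, Prod.snd_sub]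
      positivity
    obtain ⟨_, ⟨s₀, hs₀, rfl⟩, hlt⟩ :=
      exists_lt_of_csInf_lt hne (lt_add_of_pos_right _ (show 0 < δ ^ 2 by positivity))
    refine ⟨s₀, hs₀, fun s hs => ?_⟩
    have := csInf_le hbdd ⟨s, hs, rfl⟩
    linarith
  refine ⟨s₀, hs₀, ?_⟩
  have hq₀ := hz s₀ hs₀
  set x := s₀.1 - z.1 with hx
  set x' := s₀.2 - z.2 with hx'
  have hw : s₀ - z = (x, x') := rfl
  set m := ‖x‖ ^ 2 + ‖x'‖ ^ 2 with hm
  let p : X × StrongDual ℝ X → ℝ := fun e =>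
    (1 / 2) * (‖x + e.1‖ ^ 2 + ‖x' + e.2‖ ^ 2) + (δ / 2) * (‖0 + e.1‖ ^ 2 + ‖0 + e.2‖ ^ 2)
      + (x' e.1 + e.2 x) + (δ - m / 2)
  have hcont : Continuous p := by fun_prop
  have hconv : ConvexOn ℝ Set.univ p := by
    have h1 (a : X) : ConvexOn ℝ Set.univ fun e : X × StrongDual ℝ X => ‖a + e.1‖ ^ 2 :=
      (convexOn_norm_sq_add a).comp_linearMap (LinearMap.fst ℝ X (StrongDual ℝ X))
    have h2 (a : StrongDual ℝ X) :
        ConvexOn ℝ Set.univ fun e : X × StrongDual ℝ X => ‖a + e.2‖ ^ 2 :=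
      (convexOn_norm_sq_add a).comp_linearMap (LinearMap.snd ℝ X (StrongDual ℝ X))
    have h3 : ConvexOn ℝ Set.univ fun e : X × StrongDual ℝ X => x' e.1 + e.2 x :=
      ⟨convex_univ, fun a _ b _ s t _ _ _ => le_of_eq (by simp; ring)⟩
    exact (((((h1 x).add (h2 x')).smul (by norm_num : (0 : ℝ) ≤ 1 / 2)).add
      (((h1 0).add (h2 0)).smul (by positivity : 0 ≤ δ / 2))).add h3).add_const _
  -- first-order condition: compare `s₀` with `s₀ + δ • e` and use convexity of the squared norms
  have hpS : ∀ e ∈ S, 0 ≤ p e := by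
    intro e he
    have h := hmin (s₀ + δ • e) (S.add_mem hs₀ (S.smul_mem _ he))
    have hd : s₀ + δ • e - z = (x + δ • e.1, x' + δ • e.2) := by
      ext1
      · simp [hx]; abel
      · simp [hx']; abel
    rw [hd, hw] at h
    have hsq {E : Type _} [NormedAddCommGroup E] [NormedSpace ℝ E] (a d : E) :
        ‖a + δ • d‖ ^ 2 ≤ (1 - δ) * ‖a‖ ^ 2 + δ * ‖a + d‖ ^ 2 := by
      have := (convexOn_norm_sq_add a).2 (Set.mem_univ 0) (Set.mem_univ d)
        (by linarith : 0 ≤ 1 - δ) hδ.le (by ring)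
      simpa using this
    have h1 := hsq x e.1
    have h2 := hsq x' e.2
    have hqe : e.2 e.1 ≤ (‖e.1‖ ^ 2 + ‖e.2‖ ^ 2) / 2 := by
      have := (le_abs_self _).trans (e.2.le_opNorm e.1)
      nlinarith [sq_nonneg (‖e.1‖ - ‖e.2‖)]
    have h3 : δ ^ 2 * e.2 e.1 ≤ δ ^ 2 * ((‖e.1‖ ^ 2 + ‖e.2‖ ^ 2) / 2) := by gcongr
    simp only [φ, map_add, map_smul, add_apply,
      smul_apply, smul_eq_mul] at h
    have : 0 ≤ δ * p e := by
      simp only [p, zero_add]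
      linarith
    exact nonneg_of_mul_nonneg_right this hδ
  obtain ⟨l, hlp, hlS⟩ := exists_dual_le_of_nonneg_on_submodule S hconv hcont hpS
  obtain ⟨f, c, hfc⟩ := exists_dual_prod_eq hX l
  have hfcneg : f c ≤ 0 := by
    have := hadj (-c) f fun s hs => by
      have h := hlS s hs
      rw [← Prod.mk.eta (p := s), hfc] at h
      simp only [map_neg]
      linarith
    simpa using this
  -- the multiplier is `a = (c - x, f - x')`
  set C := f x + x' c - 2 * x' x - m / 2 + δ * (m + 1) with hC
  have hbound : ‖f - x'‖ ^ 2 + ‖NormedSpace.inclusionInDoubleDual ℝ X (c - x)‖ ^ 2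
      ≤ 2 * (1 + 2 * δ) * C := by
    refine norm_sq_add_norm_sq_le_of_forall_le (by positivity) fun u v => ?_
    have h := hlp (u - x, v - x')
    rw [hfc] at h
    have hsq {E : Type _} [NormedAddCommGroup E] (a b : E) :
        ‖a - b‖ ^ 2 ≤ 2 * ‖a‖ ^ 2 + 2 * ‖b‖ ^ 2 := by
      have : ‖a - b‖ ^ 2 ≤ (‖a‖ + ‖b‖) ^ 2 := by gcongr; exact norm_sub_le a b
      nlinarith [sq_nonneg (‖a‖ - ‖b‖)]
    have h1 : δ * ‖u - x‖ ^ 2 ≤ δ * (2 * ‖u‖ ^ 2 + 2 * ‖x‖ ^ 2) := by gcongr; exact hsq u x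
    have h2 : δ * ‖v - x'‖ ^ 2 ≤ δ * (2 * ‖v‖ ^ 2 + 2 * ‖x'‖ ^ 2) := by gcongr; exact hsq v x'
    simp only [p, zero_add, add_sub_cancel, map_sub, sub_apply] at h
    simp only [NormedSpace.dual_def, map_sub, sub_apply, hC, hm]
    linarith
  have hincl : ‖NormedSpace.inclusionInDoubleDual ℝ X (c - x)‖ = ‖c - x‖ :=
    (NormedSpace.inclusionInDoubleDualLi ℝ (E := X)).norm_map (c - x)
  rw [hincl] at hbound
  have hpair (g : StrongDual ℝ X) (y : X) : |g y| ≤ ‖g‖ * ‖y‖ := g.le_opNorm y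
  refine le_of_approx_duality (n := ‖f - x'‖ ^ 2 + ‖c - x‖ ^ 2) (qw := x' x)
    (qa := (f - x') (c - x)) (b := (f - x') x + x' (c - x)) (by positivity) (by positivity)
    hδ hδ' ?_ hq₀ ?_ ?_ ?_
  · simp only [map_sub, sub_apply]
    convert hbound using 1
    rw [hC]
    ring
  · have := (abs_le.1 (hpair (f - x') (c - x))).1
    nlinarith [sq_nonneg (‖f - x'‖ - ‖c - x‖)]
  · simp only [map_sub, sub_apply]
    linarith
  · have h1 := (abs_le.1 (hpair (f - x') x)).2
    have h2 := (abs_le.1 (hpair x' (c - x))).2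
    nlinarith [sq_nonneg (‖f - x'‖ - 2 * ‖x‖), sq_nonneg (‖c - x‖ - 2 * ‖x'‖)]

theorem isMaximalMonotone_of_isMonotone_adjoint (hX : IsReflexiveSpace X) {A : Multifunction X}
    (hlin : A.IsLinearRelation) (hclosed : IsClosed A.graph) (hA : A.IsMonotone)
    (hA' : A.adjoint.IsMonotone) : A.IsMaximalMonotone := by
  refine isMaximalMonotone_of_mem_graph hA fun z hz => ?_
  have hadj := A.isLinearRelation_adjoint.isMonotone_iff.1 hA'
  obtain ⟨S, hS⟩ := hlin
  have hadjS : ∀ (x : X) (x' : StrongDual ℝ X), (∀ s ∈ S, x' s.1 = s.2 x) → 0 ≤ x' x :=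
    fun x x' h => hadj (x, x') (mem_graph_adjoint.2 fun s hs => h s (by rwa [← hS] at hs))
  rw [← hS] at hz hclosed ⊢
  rw [← hclosed.closure_eq, Metric.mem_closure_iff]
  intro ε hε
  have hδ : 0 < min (1 / 26) (ε ^ 2 / 52) := by positivity
  obtain ⟨s, hs, hle⟩ := exists_mem_norm_sq_sub_le hX S hadjS z hz hδ (min_le_left _ _)
  refine ⟨s, hs, ?_⟩
  have h26 : 26 * min (1 / 26) (ε ^ 2 / 52) < ε ^ 2 := by
    have := min_le_right (1 / 26) (ε ^ 2 / 52)
    nlinarith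
  rw [dist_comm, dist_eq_norm, Prod.norm_def, max_lt_iff]
  constructor
  · refine lt_of_pow_lt_pow_left₀ 2 hε.le ?_
    have := sq_nonneg ‖s.2 - z.2‖
    rw [Prod.fst_sub]
    linarith
  · refine lt_of_pow_lt_pow_left₀ 2 hε.le ?_
    have := sq_nonneg ‖s.1 - z.1‖
    rw [Prod.snd_sub]
    linarith

end Multifunction

/-! ### The equivalences -/

theorem theorem2p3 {X : Type*} [NormedAddCommGroup X] [NormedSpace ℝ X] [CompleteSpace X]
    (hX : IsReflexiveSpace X) (A : Multifunction X)
    (hlin : A.IsLinearRelation) (hclosed : IsClosed A.graph) :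
    (A.IsMaximalMonotone ↔ A.adjoint.IsMaximalMonotone) ∧
    (A.IsMonotone →
      [A.IsMaximalMonotone, A.adjoint.IsMaximalMonotone, A.adjoint.IsMonotone].TFAE) := by
  have hAA := Multifunction.adjoint_adjoint hX hlin hclosed
  have hlin' := A.isLinearRelation_adjoint
  have h12 : A.IsMaximalMonotone → A.adjoint.IsMaximalMonotone := fun h =>
    Multifunction.isMaximalMonotone_of_isMonotone_adjoint hX hlin' A.isClosed_graph_adjoint
      (h.isMonotone_adjoint hlin) (hAA.symm ▸ h.1)
  have h31 : A.IsMonotone → A.adjoint.IsMonotone → A.IsMaximalMonotone :=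
    Multifunction.isMaximalMonotone_of_isMonotone_adjoint hX hlin hclosed
  have h21 : A.adjoint.IsMaximalMonotone → A.IsMaximalMonotone := fun h =>
    h31 (hAA ▸ h.isMonotone_adjoint hlin') h.1
  refine ⟨⟨h12, h21⟩, fun hA => ?_⟩
  tfae_have 1 → 2 := h12
  tfae_have 2 → 3 := fun h => h.1
  tfae_have 3 → 1 := h31 hA
  tfae_finish
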